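/- Let $A$ be a set (alphabet, possibly infinite), let $\theta\subset A\times A$ be an irreflexive symmetric relation, and let $M(A,\theta)=\langle A\mid ab=ba,\ (a,b)\in\theta\rangle$ be the free partially commutative monoid. For $t\in M(A,\theta)$ let $\mathrm{Alph}(t)$ be the set of letters occurring in $t$ and $IA(t)=\{a\in A: t=aw \text{ for some } w\in M(A,\theta)\}$ the set of its initial letters. For $X\subset M(A,\theta)$ let $\theta_X=\{(x_1,x_2)\in X^2:\mathrm{Alph}(x_1)\times\mathrm{Alph}(x_2)\subset\theta\}$; $X$ is called a partially commutative code if every element of the submonoid $\langle X\rangle$ has a unique decomposition as a product of elements of $X$ up to the commutations in $\theta_X$, i.e. if the canonical morphism $M(X,\theta_X)\to M(A,\theta)$ is injective. For $B\subset A$ let $Z=A\setminus B$, let $M(B,\theta_B)$ be the submonoid of $M(A,\theta)$ generated by $B$, and $$\beta_Z(B)=\{zw: z\in Z,\ w\in M(B,\theta_B),\ IA(zw)=\{z\}\}.$$ **Theorem.** Let $B\subset A$. The following assertions are equivalent. (i) $B$ is a transitively factorizing subalphabet, i.e. $\beta_Z(B)$ is a partially commutative code. (ii) For all $z_1\neq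 z_2$ in $Z$ and all $w_1,w_2,w_1',w_2'\in M(B,\theta_B)$ such that $IA(z_1w_1)=IA(z_1w_1')=\{z_1\}$ and $IA(z_2w_2)=IA(z_2w_2')=\{z_2\}$, $$z_1w_1z_2w_2=z_2w_2'z_1w_1'\ \Longrightarrow\ w_1=w_1'\ \text{ and }\ w_2=w_2'.$$ (iii) For all $(z,z')\in Z^2\cap\theta$, the dependence graph, i.e. the graph on $A$ in which two distinct letters are adjacent if and only if they are not related by $\theta$, contains no path $z-b_1-\cdots-b_n-z'$ (not necessarily induced) with all $b_1,\dots,b_n\in B$. -/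

import Mathlib

/-- The defining relations `ab = ba`, `(a, b) ∈ r`, of a partially commutative monoid. -/
inductive CommRel {A : Type*} (r : A → A → Prop) : FreeMonoid A → FreeMonoid A → Prop
  | swap {a b : A} (h : r a b) :
      CommRel r (FreeMonoid.of a * FreeMonoid.of b) (FreeMonoid.of b * FreeMonoid.of a)

/-- The free partially commutative monoid `M(A, r) = ⟨A | ab = ba, (a, b) ∈ r⟩`. -/
abbrev TraceMonoid {A : Type*} (r : A → A → Prop) : Type _ := PresentedMonoid (CommRel r)

namespace TraceMonoid

variable {A : Type*} {r : A → A → Prop}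

/-- A letter, seen as an element of the free partially commutative monoid. -/
def letter (r : A → A → Prop) (a : A) : TraceMonoid r := PresentedMonoid.of (CommRel r) a

/-- `Alph(t)`: the set of letters that occur in the trace `t`. -/
def alph (t : TraceMonoid r) : Set A := {a | ∃ u v, t = u * letter r a * v}

/-- `IA(t)`: the set of initial letters of the trace `t`. -/
def IA (t : TraceMonoid r) : Set A := {a | ∃ w, t = letter r a * w}

theorem letter_comm {a b : A} (h : r a b) :
    letter r a * letter r b = letter r b * letter r a :=
  PresentedMonoid.mk_eq_mk_of_rel (CommRel.swap h)

theorem induction_letter {P : TraceMonoid r → Prop} (t : TraceMonoid r) (one : P 1)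
    (mul : ∀ a t, P t → P (letter r a * t)) : P t := by
  induction t using PresentedMonoid.inductionOn with
  | _ w =>
    induction w using FreeMonoid.inductionOn' with
    | one => exact one
    | of_mul a w ih => exact mul a _ ih

theorem commute_of_alph (s t : TraceMonoid r) (h : ∀ a ∈ alph s, ∀ b ∈ alph t, r a b) :
    s * t = t * s := by
  change Commute s t
  induction s using induction_letter with
  | one => exact Commute.one_left t
  | mul a s ih =>
    refine Commute.mul_left ?_ (ih ?_)
    · have ha : ∀ b ∈ alph t, r a b := h a ⟨1, s, by simp⟩
      clear h ih
      induction t using induction_letter with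
      | one => exact Commute.one_right _
      | mul b t iht =>
        refine Commute.mul_right (letter_comm (ha b ⟨1, t, by simp⟩)) (iht ?_)
        rintro c ⟨u, v, rfl⟩
        exact ha c ⟨letter r b * u, v, by simp [mul_assoc]⟩
    · rintro c ⟨u, v, rfl⟩
      exact h c ⟨letter r a * u, v, by simp [mul_assoc]⟩

/-- The relation `θ_X` on a set `X` of traces: `(x, y) ∈ θ_X` iff `Alph(x) × Alph(y) ⊆ θ`. -/
def indep (X : Set (TraceMonoid r)) (x y : X) : Prop :=
  ∀ a ∈ alph x.1, ∀ b ∈ alph y.1, r a b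

/-- The canonical morphism `M(X, θ_X) → M(A, θ)`, whose image is `⟨X⟩`. -/
def ofCode (X : Set (TraceMonoid r)) : TraceMonoid (indep X) →* TraceMonoid r :=
  PresentedMonoid.lift (fun x : X => x.1) (by
    rintro _ _ ⟨h⟩
    simpa using commute_of_alph _ _ h)

/-- `X` is a partially commutative code: every trace of `⟨X⟩` has a unique decomposition on `X` up
to the commutations in `θ_X`, i.e. `M(X, θ_X) → ⟨X⟩` is an isomorphism. -/
def IsPCCode (X : Set (TraceMonoid r)) : Prop := Function.Injective (ofCode X)

/-- `M(B, θ_B)` for a subalphabet `B`, seen as the submonoid of `M(A, θ)` generated by `B`. -/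
def sub (r : A → A → Prop) (B : Set A) : Submonoid (TraceMonoid r) :=
  Submonoid.closure (letter r '' B)

/-- `β_Z(B) = {zw | z ∈ Z, w ∈ M(B, θ_B), IA(zw) = {z}}`, where `Z = A - B`. -/
def beta (r : A → A → Prop) (B : Set A) : Set (TraceMonoid r) :=
  {t | ∃ z ∈ Bᶜ, ∃ w ∈ sub r B, IA (letter r z * w) = {z} ∧ t = letter r z * w}

/-- `B` is a transitively factorizing subalphabet. -/
def IsTFSA (r : A → A → Prop) (B : Set A) : Prop := IsPCCode (beta r B)

end TraceMonoid

/-! Write X = β_Z(B). Under (i), an equation as in (ii) lifts to M(X, θ_X), where comparing letters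
matches the factors, since z₁ ≠ z₂.

If a path through B joins θ-related z and z', follow it from z' and stop before the first letter b
dependent on z. This yields z'u and z'ub in X with u independent of z, and then z · z'ub = z'u · zb
violates (ii) (`exists_of_walk`).

If there is no such path, injectivity is proved by induction on the last letter a of the common
image. For a ∉ B, every preimage ends with the code letter a. For a ∈ B, Levi's lemma says that a
ends a code letter whose later factors are all independent of a. Removing a is undone by an
operation on M(X, θ_X), `appendLetter`, so the shorter preimage determines the longer one. That
operation is well defined because two independent elements of X cannot both depend on a: a path
would result (`NoPath.adj_or_adj`). -/

namespace TraceMonoid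

/-! ### Letters, content and projections of traces -/

section General

variable {A : Type*} {r : A → A → Prop}

theorem induction_letter_right {P : TraceMonoid r → Prop} (t : TraceMonoid r) (one : P 1)
    (mul : ∀ t a, P t → P (t * letter r a)) : P t := by
  suffices h : ∀ s, P s → P (s * t) by simpa using h 1 one
  induction t using induction_letter with
  | one => intro s hs; simpa using hs
  | mul a t ih => intro s hs; rw [← mul_assoc]; exact ih _ (mul s a hs)

/-- The morphism `M(A, r) → M` induced by a map on letters whose values commute along `r`. -/
def liftLetter {M : Type*} [Monoid M] (f : A → M)
    (hf : ∀ a b, r a b → f a * f b = f b * f a) : TraceMonoid r →* M :=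
  PresentedMonoid.lift f (by
    rintro _ _ ⟨h⟩
    simpa using hf _ _ h)

@[simp] theorem liftLetter_letter {M : Type*} [Monoid M] (f : A → M)
    (hf : ∀ a b, r a b → f a * f b = f b * f a) (a : A) :
    liftLetter f hf (letter r a) = f a := rfl

/-- The right action of `M(A, r)` on a type, from an action of the letters. -/
def fold {S : Type*} (f : A → S → S) (hf : ∀ a b, r a b → ∀ s, f a (f b s) = f b (f a s))
    (t : TraceMonoid r) (s : S) : S :=
  (liftLetter (M := (Function.End S)ᵐᵒᵖ) (fun a => MulOpposite.op (f a)) (by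
    intro a b h
    refine MulOpposite.unop_injective ?_
    funext s
    exact (hf a b h s).symm) t).unop s

@[simp] theorem fold_one {S : Type*} (f : A → S → S)
    (hf : ∀ a b, r a b → ∀ s, f a (f b s) = f b (f a s)) (s : S) :
    fold f hf 1 s = s := by
  simp only [fold, map_one]; rfl

@[simp] theorem fold_mul_letter {S : Type*} (f : A → S → S)
    (hf : ∀ a b, r a b → ∀ s, f a (f b s) = f b (f a s)) (t : TraceMonoid r) (a : A) (s : S) :
    fold f hf (t * letter r a) s = f a (fold f hf t s) := by
  simp only [fold, map_mul]; rfl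

/-- The commutative image of a trace. -/
def content : TraceMonoid r →* Multiplicative (Multiset A) :=
  liftLetter (fun a => Multiplicative.ofAdd {a}) (fun _ _ _ => mul_comm _ _)

@[simp] theorem content_letter (a : A) :
    content (letter r a) = Multiplicative.ofAdd {a} := rfl

theorem mem_alph {t : TraceMonoid r} {a : A} : a ∈ alph t ↔ a ∈ (content t).toAdd := by
  constructor
  · rintro ⟨u, v, rfl⟩
    simp
  · induction t using induction_letter_right with
    | one => simp
    | mul t b ih =>
      simp only [map_mul, content_letter, toAdd_mul, toAdd_ofAdd, Multiset.mem_add,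
        Multiset.mem_singleton]
      rintro (h | rfl)
      · obtain ⟨u, v, rfl⟩ := ih h
        exact ⟨u, v * letter r b, by simp only [mul_assoc]⟩
      · exact ⟨t, 1, by simp⟩

@[simp] theorem mem_alph_mul {s t : TraceMonoid r} {a : A} :
    a ∈ alph (s * t) ↔ a ∈ alph s ∨ a ∈ alph t := by
  simp [mem_alph]

@[simp] theorem mem_alph_letter {a b : A} : a ∈ alph (letter r b) ↔ a = b := by
  simp [mem_alph]

@[simp] theorem not_mem_alph_one {a : A} : a ∉ alph (1 : TraceMonoid r) := by
  simp [mem_alph]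

theorem mul_letter_ne_one (t : TraceMonoid r) (a : A) : t * letter r a ≠ 1 := by
  intro h
  have : a ∈ alph (t * letter r a) := by simp
  rw [h] at this
  exact not_mem_alph_one this

theorem mem_sub {B : Set A} {t : TraceMonoid r} : t ∈ sub r B ↔ alph t ⊆ B := by
  constructor
  · intro h
    induction h using Submonoid.closure_induction with
    | mem x hx =>
      obtain ⟨b, hb, rfl⟩ := hx
      intro a ha
      rw [mem_alph_letter.1 ha]
      exact hb
    | one => intro a ha; exact absurd ha not_mem_alph_one
    | mul x y _ _ ihx ihy =>
      intro a ha
      rcases mem_alph_mul.1 ha with h | h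
      · exact ihx h
      · exact ihy h
  · induction t using induction_letter_right with
    | one => intro _; exact one_mem _
    | mul t b ih =>
      intro h
      exact mul_mem (ih fun a ha => h (mem_alph_mul.2 (Or.inl ha)))
        (Submonoid.subset_closure ⟨b, h (by simp), rfl⟩)

theorem IA_subset_mul (s t : TraceMonoid r) : IA s ⊆ IA (s * t) := by
  rintro a ⟨w, rfl⟩
  exact ⟨w * t, by simp only [mul_assoc]⟩

@[simp] theorem ofCode_letter (X : Set (TraceMonoid r)) (x : X) :
    ofCode X (letter (indep X) x) = x.1 := rfl

/-- The projection of `M(A, r)` onto the submonoid generated by `B`. -/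
noncomputable def proj (B : Set A) : TraceMonoid r →* TraceMonoid r := by
  classical
  exact liftLetter (fun a => if a ∈ B then letter r a else 1) (by
    intro a b h
    by_cases ha : a ∈ B <;> by_cases hb : b ∈ B <;> simp [ha, hb, letter_comm h])

theorem proj_letter_of_notMem {B : Set A} {a : A} (ha : a ∉ B) : proj B (letter r a) = 1 := by
  simp [proj, ha]

theorem proj_letter_of_mem {B : Set A} {a : A} (ha : a ∈ B) :
    proj B (letter r a) = letter r a := by
  simp [proj, ha]

theorem proj_of_mem_sub {B : Set A} {t : TraceMonoid r} (ht : t ∈ sub r B) : proj B t = t := by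
  induction ht using Submonoid.closure_induction with
  | mem x hx =>
    obtain ⟨b, hb, rfl⟩ := hx
    exact proj_letter_of_mem hb
  | one => exact map_one _
  | mul x y _ _ ihx ihy => rw [map_mul, ihx, ihy]

theorem letter_mul_cancel {B : Set A} {z : A} (hz : z ∉ B) {w w' : TraceMonoid r}
    (hw : w ∈ sub r B) (hw' : w' ∈ sub r B) (h : letter r z * w = letter r z * w') : w = w' := by
  have := congrArg (proj B) h
  simpa [proj_letter_of_notMem hz, proj_of_mem_sub hw, proj_of_mem_sub hw'] using this

end General

/-! ### Levi's lemma for last letters; initial letters -/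

section Levi

variable {A : Type*} {θ : SimpleGraph A}

open Classical in
/-- One step of the computation of `eraseRight`. -/
noncomputable def eraseStep (a c : A) (p : TraceMonoid θ.Adj × Option (TraceMonoid θ.Adj)) :
    TraceMonoid θ.Adj × Option (TraceMonoid θ.Adj) :=
  -- The trace read so far is carried along because meeting `a` resets the answer to it.
  (p.1 * letter θ.Adj c,
    if c = a then some p.1
    else if θ.Adj a c then p.2.map (· * letter θ.Adj c) else none)

theorem eraseStep_comm (a c d : A) (h : θ.Adj c d)
    (p : TraceMonoid θ.Adj × Option (TraceMonoid θ.Adj)) :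
    eraseStep a c (eraseStep a d p) = eraseStep a d (eraseStep a c p) := by
  have hcd : ∀ t : TraceMonoid θ.Adj,
      t * letter θ.Adj d * letter θ.Adj c = t * letter θ.Adj c * letter θ.Adj d := fun t => by
    rw [mul_assoc, mul_assoc, letter_comm h]
  obtain ⟨t, q⟩ := p
  simp only [eraseStep, hcd, Prod.mk.injEq, true_and]
  by_cases hc : c = a
  · subst hc
    have hd : d ≠ c := h.ne'
    simp [hd, h]
  · by_cases hd : d = a
    · subst hd
      simp [hc, h.symm]
    · simp only [hc, hd, if_false]
      by_cases h1 : θ.Adj a c <;> by_cases h2 : θ.Adj a d <;> simp [h1, h2]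
      cases q <;> simp [letter_comm h]

/-- `eraseRight a t` is the trace `s` such that `t = s * a`, if it exists. -/
noncomputable def eraseRight (a : A) (t : TraceMonoid θ.Adj) : Option (TraceMonoid θ.Adj) :=
  (fold (eraseStep a) (eraseStep_comm a) t (1, none)).2

theorem fold_eraseStep_fst (a : A) (t : TraceMonoid θ.Adj) :
    (fold (eraseStep a) (eraseStep_comm a) t (1, none)).1 = t := by
  induction t using induction_letter_right with
  | one => simp
  | mul t b ih => rw [fold_mul_letter, eraseStep, ih]

open Classical in
theorem eraseRight_mul_letter (a c : A) (t : TraceMonoid θ.Adj) :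
    eraseRight a (t * letter θ.Adj c) =
      if c = a then some t
      else if θ.Adj a c then (eraseRight a t).map (· * letter θ.Adj c) else none := by
  rw [eraseRight, fold_mul_letter, eraseStep, fold_eraseStep_fst]
  rfl

theorem eq_mul_letter_of_eraseRight {a : A} {t s : TraceMonoid θ.Adj}
    (h : eraseRight a t = some s) : t = s * letter θ.Adj a := by
  induction t using induction_letter_right generalizing s with
  | one => simp [eraseRight] at h
  | mul t c ih =>
    rw [eraseRight_mul_letter] at h
    split_ifs at h with hc hac
    · rw [← Option.some.inj h, hc]
    · obtain ⟨q, hq, rfl⟩ := Option.map_eq_some_iff.1 h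
      rw [ih hq, mul_assoc, mul_assoc, letter_comm hac]

/-- Evaluate `eraseRight a`, a well-defined function of the trace, on both sides. The first case
includes right cancellation. -/
theorem mul_letter_eq_mul_letter {a c : A} {s t : TraceMonoid θ.Adj}
    (h : s * letter θ.Adj a = t * letter θ.Adj c) :
    (a = c ∧ s = t) ∨
      (θ.Adj a c ∧ ∃ q, s = q * letter θ.Adj c ∧ t = q * letter θ.Adj a) := by
  have h1 : eraseRight a (s * letter θ.Adj a) = some s := by simp [eraseRight_mul_letter]
  rw [h, eraseRight_mul_letter] at h1
  split_ifs at h1 with hc hac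
  · exact Or.inl ⟨hc.symm, (Option.some.inj h1).symm⟩
  · obtain ⟨q, hq, rfl⟩ := Option.map_eq_some_iff.1 h1
    exact Or.inr ⟨hac, q, rfl, eq_mul_letter_of_eraseRight hq⟩

theorem mul_letter_eq_letter {a c : A} {s : TraceMonoid θ.Adj}
    (h : s * letter θ.Adj a = letter θ.Adj c) : a = c ∧ s = 1 := by
  rw [← one_mul (letter θ.Adj c)] at h
  rcases mul_letter_eq_mul_letter h with h | ⟨-, q, -, h⟩
  · exact h
  · exact absurd h.symm (mul_letter_ne_one _ _)

/-- Levi's lemma for the last letter of a product. -/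
theorem mul_letter_eq_mul {a : A} {s u v : TraceMonoid θ.Adj}
    (h : s * letter θ.Adj a = u * v) :
    (∃ v', v = v' * letter θ.Adj a ∧ s = u * v') ∨
      (∃ u', u = u' * letter θ.Adj a ∧ (∀ b ∈ alph v, θ.Adj a b) ∧ s = u' * v) := by
  induction v using induction_letter_right generalizing s with
  | one => exact Or.inr ⟨s, by simpa using h.symm, by simp, by simp⟩
  | mul v c ih =>
    rw [← mul_assoc] at h
    rcases mul_letter_eq_mul_letter h with ⟨rfl, rfl⟩ | ⟨hac, q, rfl, hq⟩
    · exact Or.inl ⟨v, rfl, rfl⟩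
    · rcases ih hq.symm with ⟨v', rfl, rfl⟩ | ⟨u', rfl, hv, rfl⟩
      · refine Or.inl ⟨v' * letter θ.Adj c, ?_, by rw [mul_assoc]⟩
        rw [mul_assoc, mul_assoc, letter_comm hac]
      · refine Or.inr ⟨u', rfl, ?_, by rw [mul_assoc]⟩
        intro b hb
        rcases mem_alph_mul.1 hb with hb | hb
        · exact hv b hb
        · rw [mem_alph_letter.1 hb]
          exact hac

theorem mul_letter_comm_of_alph {b : A} {t : TraceMonoid θ.Adj} (h : ∀ a ∈ alph t, θ.Adj b a) :
    t * letter θ.Adj b = letter θ.Adj b * t := by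
  refine commute_of_alph _ _ fun a ha c hc => ?_
  rw [mem_alph_letter.1 hc]
  exact (h a ha).symm

/-- By Levi, a new initial letter could only be `b` itself, moved to the front past all of `t`. -/
theorem IA_mul_letter {b : A} {t : TraceMonoid θ.Adj} (h : ¬ ∀ a ∈ alph t, θ.Adj b a) :
    IA (t * letter θ.Adj b) = IA t := by
  refine (Set.Subset.antisymm ?_ (IA_subset_mul _ _))
  rintro c ⟨w, hw⟩
  rcases mul_letter_eq_mul hw with ⟨w', -, ht⟩ | ⟨u, hu, hwb, ht⟩
  · exact ⟨w', ht⟩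
  · obtain ⟨-, rfl⟩ := mul_letter_eq_letter hu.symm
    rw [one_mul] at ht
    exact absurd (ht ▸ hwb) h

theorem exists_not_adj_of_IA {B : Set A} {z b : A} {t : TraceMonoid θ.Adj} (hz : z ∉ B)
    (hb : b ∈ B) (h : IA (t * letter θ.Adj b) = {z}) : ¬ ∀ a ∈ alph t, θ.Adj b a := by
  intro hc
  have hmem : b ∈ IA (t * letter θ.Adj b) := ⟨t, mul_letter_comm_of_alph hc⟩
  rw [h, Set.mem_singleton_iff] at hmem
  exact hz (hmem ▸ hb)

theorem IA_letter (z : A) : IA (letter θ.Adj z) = {z} := by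
  refine Set.Subset.antisymm ?_ ?_
  · rintro c ⟨w, hw⟩
    have : c ∈ alph (letter θ.Adj z) := by rw [hw]; simp
    simpa using this
  · rintro _ rfl
    exact ⟨1, by simp⟩

theorem IA_eq_of_mul {z : A} {w v : TraceMonoid θ.Adj}
    (h : IA (letter θ.Adj z * (w * v)) = {z}) : IA (letter θ.Adj z * w) = {z} := by
  refine Set.Subset.antisymm ?_ (by rintro _ rfl; exact ⟨w, rfl⟩)
  rw [← h, ← mul_assoc]
  exact IA_subset_mul _ _

end Levi

/-! ### The set β_Z(B) and walks in the dependence graph -/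

section Beta

variable {A : Type*} {θ : SimpleGraph A} {B : Set A}

theorem letter_mem_beta {z : A} (hz : z ∉ B) : letter θ.Adj z ∈ beta θ.Adj B :=
  ⟨z, hz, 1, one_mem _, by rw [mul_one]; exact IA_letter z, by rw [mul_one]⟩

theorem mul_letter_mem_beta {x : TraceMonoid θ.Adj} {b : A} (hx : x ∈ beta θ.Adj B)
    (hb : b ∈ B) (h : ¬ ∀ a ∈ alph x, θ.Adj b a) : x * letter θ.Adj b ∈ beta θ.Adj B := by
  obtain ⟨z, hz, w, hw, hIA, rfl⟩ := hx
  refine ⟨z, hz, w * letter θ.Adj b, mul_mem hw (Submonoid.subset_closure ⟨b, hb, rfl⟩), ?_,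
    mul_assoc _ _ _⟩
  rw [← mul_assoc, IA_mul_letter h, hIA]

theorem of_mul_letter_mem_beta {y : TraceMonoid θ.Adj} {b : A} (hb : b ∈ B)
    (h : y * letter θ.Adj b ∈ beta θ.Adj B) :
    y ∈ beta θ.Adj B ∧ ¬ ∀ a ∈ alph y, θ.Adj b a := by
  obtain ⟨z, hz, w, hw, hIA, hy⟩ := h
  refine ⟨?_, exists_not_adj_of_IA hz hb (hy ▸ hIA)⟩
  rcases mul_letter_eq_mul hy with ⟨w', rfl, rfl⟩ | ⟨u, hu, -, -⟩
  · refine ⟨z, hz, w', ?_, IA_eq_of_mul hIA, rfl⟩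
    rw [mem_sub] at hw ⊢
    exact fun a ha => hw (mem_alph_mul.2 (Or.inl ha))
  · exact absurd ((mul_letter_eq_letter hu.symm).1 ▸ hb) hz

theorem eq_one_of_mul_letter_mem_beta {y : TraceMonoid θ.Adj} {a : A} (ha : a ∉ B)
    (h : y * letter θ.Adj a ∈ beta θ.Adj B) : y = 1 := by
  obtain ⟨z, hz, w, hw, hIA, hy⟩ := h
  rcases mul_letter_eq_mul hy with ⟨w', rfl, rfl⟩ | ⟨u, hu, hcomm, rfl⟩
  · exact absurd (mem_sub.1 hw (by simp)) ha
  · obtain ⟨rfl, rfl⟩ := mul_letter_eq_letter hu.symm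
    rw [one_mul]
    -- Here `a` commutes with `w`, so a first letter of `w` would be initial, hence equal to `a`,
    -- against irreflexivity.
    induction w using induction_letter with
    | one => rfl
    | mul b w _ =>
      have hb : b ∈ IA (letter θ.Adj a * (letter θ.Adj b * w)) := by
        rw [← mul_letter_comm_of_alph hcomm]
        exact ⟨w * letter θ.Adj a, by simp only [mul_assoc]⟩
      rw [hIA, Set.mem_singleton_iff] at hb
      exact absurd (hcomm b (by simp)) (hb ▸ θ.irrefl)

/-- Every letter of `z w ∈ β_Z(B)` is joined to `z` by a walk through `B`. -/
theorem exists_walk_of_mem_alph {z : A} (hz : z ∉ B) {w : TraceMonoid θ.Adj}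
    (hw : w ∈ sub θ.Adj B) (hIA : IA (letter θ.Adj z * w) = {z}) :
    ∀ a ∈ alph (letter θ.Adj z * w),
      ∃ p : θᶜ.Walk z a, ∀ v ∈ p.support, v = z ∨ v ∈ B := by
  induction w using induction_letter_right with
  | one =>
    intro a ha
    obtain rfl : a = z := by simpa using ha
    exact ⟨.nil, by simp⟩
  | mul w b ih =>
    have hb : b ∈ B := mem_sub.1 hw (by simp)
    have hw' : w ∈ sub θ.Adj B :=
      mem_sub.2 fun a ha => mem_sub.1 hw (mem_alph_mul.2 (Or.inl ha))
    have ih' := ih hw' (IA_eq_of_mul hIA)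
    intro a ha
    rw [← mul_assoc, mem_alph_mul, mem_alph_letter] at ha
    rcases ha with ha | rfl
    · exact ih' a ha
    · rw [← mul_assoc] at hIA
      have hdep := exists_not_adj_of_IA hz hb hIA
      push Not at hdep
      obtain ⟨c, hc, hac⟩ := hdep
      obtain ⟨p, hp⟩ := ih' c hc
      by_cases hca : c = a
      · subst hca
        exact ⟨p, hp⟩
      · refine ⟨p.concat ((SimpleGraph.compl_adj _ _ _).2 ⟨hca, fun h => hac h.symm⟩), ?_⟩
        intro v hv
        rw [SimpleGraph.Walk.support_concat] at hv
        simp only [List.mem_append, List.mem_singleton] at hv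
        rcases hv with hv | rfl
        · exact hp v hv
        · exact Or.inr hb

/-- No two `θ`-related letters outside `B` are joined by a path through `B` in the dependence
graph. -/
def NoPath (θ : SimpleGraph A) (B : Set A) : Prop :=
  ∀ z ∈ Bᶜ, ∀ z' ∈ Bᶜ, θ.Adj z z' →
    ¬ ∃ p : θᶜ.Walk z z', p.IsPath ∧ ∀ v ∈ p.support, v ≠ z → v ≠ z' → v ∈ B

theorem NoPath.adj_of_mem_alph (H : NoPath θ B) {z z' : A} {w w' : TraceMonoid θ.Adj}
    (hz : z ∉ B) (hz' : z' ∉ B) (hw : w ∈ sub θ.Adj B) (hw' : w' ∈ sub θ.Adj B)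
    (hIA : IA (letter θ.Adj z * w) = {z}) (hIA' : IA (letter θ.Adj z' * w') = {z'})
    (hzz' : θ.Adj z z') :
    ∀ a ∈ alph (letter θ.Adj z * w), ∀ b ∈ alph (letter θ.Adj z' * w'), θ.Adj a b := by
  classical
  intro a ha b hb
  by_contra hab
  obtain ⟨p, hp⟩ := exists_walk_of_mem_alph hz hw hIA a ha
  obtain ⟨q, hq⟩ := exists_walk_of_mem_alph hz' hw' hIA' b hb
  suffices h : ∃ s : θᶜ.Walk z z', ∀ v ∈ s.support, v ∈ p.support ∨ v ∈ q.support by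
    obtain ⟨s, hs⟩ := h
    refine H z hz z' hz' hzz' ⟨s.bypass, s.bypass_isPath, fun v hv h1 h2 => ?_⟩
    rcases hs v (s.support_bypass_subset_support hv) with h | h
    · exact (hp v h).resolve_left h1
    · exact (hq v h).resolve_left h2
  -- The two walks either meet or are linked by one dependence edge.
  by_cases heq : a = b
  · subst heq
    exact ⟨p.append q.reverse, fun v hv => by
      simpa [SimpleGraph.Walk.mem_support_append_iff] using hv⟩
  · refine ⟨p.append (.cons ((SimpleGraph.compl_adj _ _ _).2 ⟨heq, hab⟩) q.reverse), ?_⟩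
    intro v hv
    rw [SimpleGraph.Walk.mem_support_append_iff, SimpleGraph.Walk.support_cons,
      List.mem_cons, SimpleGraph.Walk.support_reverse, List.mem_reverse] at hv
    rcases hv with hv | rfl | hv
    · exact Or.inl hv
    · exact Or.inl p.end_mem_support
    · exact Or.inr hv

/-- If `x` and `x'` are independent elements of `β_Z(B)` then a letter of `B` is independent of
one of them. -/
theorem NoPath.adj_or_adj (H : NoPath θ B) {b : A} (hb : b ∈ B) (x x' : beta θ.Adj B)
    (hxx' : indep _ x x') (hx : ¬ ∀ a ∈ alph x.1, θ.Adj b a) : ∀ a ∈ alph x'.1, θ.Adj b a := by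
  -- `x b` is again in β_Z(B) with the same head `z`, so its letter `b` is independent of `x'`.
  obtain ⟨z, hz, w, hw, hIA, he⟩ := mul_letter_mem_beta x.2 hb hx
  obtain ⟨z', hz', w', hw', hIA', he'⟩ := x'.2
  have hzx : z ∈ alph x.1 := by
    have : z ∈ alph (x.1 * letter θ.Adj b) := by rw [he]; simp
    rcases mem_alph_mul.1 this with h | h
    · exact h
    · exact absurd (mem_alph_letter.1 h ▸ hb) hz
  have hzz' : θ.Adj z z' := hxx' z hzx z' (by rw [he']; simp)
  intro a ha
  rw [he'] at ha
  exact H.adj_of_mem_alph hz hz' hw hw' hIA hIA' hzz' b (by rw [← he]; simp) a ha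

/-! ### Right multiplication by a letter of B on M(X, θ_X) -/

open Classical in
/-- One step of the computation of `appendLetter`. -/
noncomputable def appendStep {b : A} (hb : b ∈ B) (x : beta θ.Adj B)
    (p : TraceMonoid (indep (beta θ.Adj B)) × Option (TraceMonoid (indep (beta θ.Adj B)))) :
    TraceMonoid (indep (beta θ.Adj B)) × Option (TraceMonoid (indep (beta θ.Adj B))) :=
  (p.1 * letter _ x,
    -- `b` is absorbed by the last code letter depending on it; `none` means that there is none.
    if h : ∀ a ∈ alph x.1, θ.Adj b a then p.2.map (· * letter _ x)
    else some (p.1 * letter _ ⟨x.1 * letter θ.Adj b, mul_letter_mem_beta x.2 hb h⟩))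

theorem indep_symm {x y : beta θ.Adj B} (h : indep _ x y) : indep _ y x :=
  fun a ha b hb => (h b hb a ha).symm

theorem indep_mul_letter {b : A} {x y x' : beta θ.Adj B} (h : indep _ x y)
    (hx' : x'.1 = x.1 * letter θ.Adj b) (hy : ∀ a ∈ alph y.1, θ.Adj b a) : indep _ x' y := by
  intro a ha c hc
  rw [hx', mem_alph_mul, mem_alph_letter] at ha
  rcases ha with ha | rfl
  · exact h a ha c hc
  · exact hy c hc

theorem mul_letter_mul_letter {X : Set (TraceMonoid θ.Adj)} {x y : X} (h : indep X x y)
    (t : TraceMonoid (indep X)) :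
    t * letter _ x * letter _ y = t * letter _ y * letter _ x := by
  rw [mul_assoc, mul_assoc, letter_comm h]

theorem NoPath.appendStep_comm (H : NoPath θ B) {b : A} (hb : b ∈ B) (x y : beta θ.Adj B)
    (h : indep _ x y)
    (p : TraceMonoid (indep (beta θ.Adj B)) × Option (TraceMonoid (indep (beta θ.Adj B)))) :
    appendStep hb x (appendStep hb y p) = appendStep hb y (appendStep hb x p) := by
  obtain ⟨t, q⟩ := p
  simp only [appendStep, mul_letter_mul_letter h, Prod.mk.injEq, true_and]
  by_cases hx : ∀ a ∈ alph x.1, θ.Adj b a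
  · by_cases hy : ∀ a ∈ alph y.1, θ.Adj b a
    · rw [dif_pos hx, dif_pos hy, dif_pos hy, dif_pos hx]
      cases q <;> simp [mul_letter_mul_letter h]
    · rw [dif_pos hx, dif_neg hy, dif_neg hy, Option.map_some,
        mul_letter_mul_letter (indep_mul_letter (indep_symm h) rfl hx)]
  · have hy := H.adj_or_adj hb x y h hx
    rw [dif_neg hx, dif_pos hy, dif_neg hx, Option.map_some,
      mul_letter_mul_letter (indep_mul_letter h rfl hy)]

/-- Multiplication on the right by a letter of `B`, lifted to `M(X, θ_X)` for `X = β_Z(B)`. -/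
noncomputable def appendLetter (H : NoPath θ B) {b : A} (hb : b ∈ B)
    (t : TraceMonoid (indep (beta θ.Adj B))) : Option (TraceMonoid (indep (beta θ.Adj B))) :=
  (fold (appendStep hb) (H.appendStep_comm hb) t (1, none)).2

theorem fold_appendStep_fst (H : NoPath θ B) {b : A} (hb : b ∈ B)
    (t : TraceMonoid (indep (beta θ.Adj B))) :
    (fold (appendStep hb) (H.appendStep_comm hb) t (1, none)).1 = t := by
  induction t using induction_letter_right with
  | one => simp
  | mul t b ih => rw [fold_mul_letter, appendStep, ih]

theorem appendLetter_mul_of_adj (H : NoPath θ B) {b : A} (hb : b ∈ B)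
    (t : TraceMonoid (indep (beta θ.Adj B))) (x : beta θ.Adj B)
    (hx : ∀ a ∈ alph x.1, θ.Adj b a) :
    appendLetter H hb (t * letter _ x) = (appendLetter H hb t).map (· * letter _ x) := by
  rw [appendLetter, fold_mul_letter, appendStep, dif_pos hx]
  rfl

theorem appendLetter_mul_of_not_adj (H : NoPath θ B) {b : A} (hb : b ∈ B)
    (t : TraceMonoid (indep (beta θ.Adj B))) (x y : beta θ.Adj B)
    (hx : ¬ ∀ a ∈ alph x.1, θ.Adj b a) (hy : y.1 = x.1 * letter θ.Adj b) :
    appendLetter H hb (t * letter _ x) = some (t * letter _ y) := by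
  obtain ⟨y, hmem⟩ := y
  subst hy
  rw [appendLetter, fold_mul_letter, appendStep, dif_neg hx, fold_appendStep_fst H]

/-! ### Injectivity in the absence of paths -/

theorem ofCode_eq_one {ξ : TraceMonoid (indep (beta θ.Adj B))}
    (h : ofCode (beta θ.Adj B) ξ = 1) : ξ = 1 := by
  induction ξ using induction_letter_right with
  | one => rfl
  | mul ξ x _ =>
    obtain ⟨z, -, w, -, -, hx⟩ := x.2
    have hz : z ∈ alph (ofCode (beta θ.Adj B) (ξ * letter _ x)) := by
      rw [map_mul, ofCode_letter, hx]; simp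
    rw [h] at hz
    exact absurd hz not_mem_alph_one

theorem exists_of_ofCode_eq_mul_of_notMem {a : A} (ha : a ∉ B)
    {ξ : TraceMonoid (indep (beta θ.Adj B))} {s : TraceMonoid θ.Adj}
    (h : s * letter θ.Adj a = ofCode (beta θ.Adj B) ξ) :
    ∃ ξ', ξ = ξ' * letter _ ⟨letter θ.Adj a, letter_mem_beta ha⟩ ∧
      ofCode (beta θ.Adj B) ξ' = s := by
  induction ξ using induction_letter_right generalizing s with
  | one => exact absurd (h.trans (map_one _)) (mul_letter_ne_one _ _)
  | mul ξ x ih =>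
    rw [map_mul, ofCode_letter] at h
    rcases mul_letter_eq_mul h with ⟨y, hy, rfl⟩ | ⟨u, hu, hx, rfl⟩
    · obtain rfl := eq_one_of_mul_letter_mem_beta ha (hy ▸ x.2)
      refine ⟨ξ, ?_, by simp⟩
      congr 2
      exact Subtype.ext (by simpa using hy)
    · obtain ⟨ξ', rfl, rfl⟩ := ih hu.symm
      refine ⟨ξ' * letter _ x, ?_, by simp⟩
      refine mul_letter_mul_letter ?_ ξ'
      intro c hc d hd
      rw [mem_alph_letter.1 hc]
      exact hx d hd

theorem exists_of_ofCode_eq_mul_of_mem (H : NoPath θ B) {b : A} (hb : b ∈ B)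
    {ξ : TraceMonoid (indep (beta θ.Adj B))} {s : TraceMonoid θ.Adj}
    (h : s * letter θ.Adj b = ofCode (beta θ.Adj B) ξ) :
    ∃ ξ', appendLetter H hb ξ' = some ξ ∧ ofCode (beta θ.Adj B) ξ' = s := by
  induction ξ using induction_letter_right generalizing s with
  | one => exact absurd (h.trans (map_one _)) (mul_letter_ne_one _ _)
  | mul ξ x ih =>
    rw [map_mul, ofCode_letter] at h
    rcases mul_letter_eq_mul h with ⟨y, hy, rfl⟩ | ⟨u, hu, hx, rfl⟩
    · obtain ⟨hmem, hdep⟩ := of_mul_letter_mem_beta hb (hy ▸ x.2)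
      exact ⟨ξ * letter _ ⟨y, hmem⟩, appendLetter_mul_of_not_adj H hb ξ ⟨y, hmem⟩ x hdep hy,
        by simp⟩
    · obtain ⟨ξ', hξ', rfl⟩ := ih hu.symm
      exact ⟨ξ' * letter _ x, by rw [appendLetter_mul_of_adj H hb ξ' x hx, hξ', Option.map_some],
        by simp⟩

theorem NoPath.isTFSA (H : NoPath θ B) : IsTFSA θ.Adj B := by
  intro ξ η hξη
  generalize ht : ofCode (beta θ.Adj B) η = t at hξη
  induction t using induction_letter_right generalizing ξ η with
  | one => rw [ofCode_eq_one ht, ofCode_eq_one hξη]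
  | mul t a ih =>
    by_cases ha : a ∈ B
    · obtain ⟨ξ', hξ', hξt⟩ := exists_of_ofCode_eq_mul_of_mem H ha hξη.symm
      obtain ⟨η', hη', hηt⟩ := exists_of_ofCode_eq_mul_of_mem H ha ht.symm
      rw [ih hηt hξt, hη'] at hξ'
      exact (Option.some.inj hξ').symm
    · obtain ⟨ξ', rfl, hξt⟩ := exists_of_ofCode_eq_mul_of_notMem ha hξη.symm
      obtain ⟨η', rfl, hηt⟩ := exists_of_ofCode_eq_mul_of_notMem ha ht.symm
      rw [ih hηt hξt]

/-- If `z` and `z'` are joined by a walk through `B` in the dependence graph, then some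
`z' u b ∈ β_Z(B)` has `u` independent of `z` and `b` dependent on `z`. -/
theorem exists_of_walk {z z' : A} (hzz' : θ.Adj z z') :
    ∀ {v z₀ : A} (p : θᶜ.Walk v z₀), z₀ = z →
      (∀ c ∈ p.support, c ≠ z → c ≠ z' → c ∈ B) → θ.Adj z v →
      ∀ u ∈ sub θ.Adj B, IA (letter θ.Adj z' * u) = {z'} → (∀ a ∈ alph u, θ.Adj z a) →
        v ∈ alph (letter θ.Adj z' * u) →
      ∃ u ∈ sub θ.Adj B, ∃ b ∈ B, IA (letter θ.Adj z' * u) = {z'} ∧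
        IA (letter θ.Adj z' * (u * letter θ.Adj b)) = {z'} ∧
        (∀ a ∈ alph u, θ.Adj z a) ∧ ¬ θ.Adj z b := by
  intro v z₀ p
  induction p with
  | nil =>
    rintro rfl _ h
    exact absurd h θ.irrefl
  | @cons v v₁ z₀ h p ih =>
    rintro rfl hp hv u hu hIA hzu hvu
    rw [SimpleGraph.compl_adj] at h
    by_cases h1 : v₁ = z₀
    · subst h1
      exact absurd hv.symm h.2
    have hp' : ∀ c ∈ p.support, c ≠ z₀ → c ≠ z' → c ∈ B := fun c hc =>
      hp c (by rw [SimpleGraph.Walk.support_cons]; exact List.mem_cons_of_mem _ hc)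
    -- A walk returning to `z'` restarts the construction with `u = 1`.
    by_cases h2 : v₁ = z'
    · subst h2
      exact ih rfl hp' hzz' 1 (one_mem _) (by rw [mul_one]; exact IA_letter _) (by simp) (by simp)
    have hB : v₁ ∈ B := hp' v₁ p.start_mem_support h1 h2
    have hIA₁ : IA (letter θ.Adj z' * (u * letter θ.Adj v₁)) = {z'} := by
      rw [← mul_assoc, IA_mul_letter, hIA]
      exact fun hall => h.2 (hall v hvu).symm
    by_cases h3 : θ.Adj z₀ v₁
    · refine ih rfl hp' h3 (u * letter θ.Adj v₁)
        (mul_mem hu (Submonoid.subset_closure ⟨v₁, hB, rfl⟩)) hIA₁ ?_ (by simp)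
      intro a ha
      rw [mem_alph_mul, mem_alph_letter] at ha
      rcases ha with ha | rfl
      · exact hzu a ha
      · exact h3
    · exact ⟨u, hu, v₁, hB, hIA, hIA₁, hzu, h3⟩

end Beta

end TraceMonoid

open TraceMonoid in
theorem mainTheorem1 {A : Type*} (θ : SimpleGraph A) (B : Set A) :
    List.TFAE [
      TraceMonoid.IsTFSA θ.Adj B,
      ∀ z₁ ∈ Bᶜ, ∀ z₂ ∈ Bᶜ, z₁ ≠ z₂ →
        ∀ w₁ ∈ TraceMonoid.sub θ.Adj B, ∀ w₂ ∈ TraceMonoid.sub θ.Adj B,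
        ∀ w₁' ∈ TraceMonoid.sub θ.Adj B, ∀ w₂' ∈ TraceMonoid.sub θ.Adj B,
          TraceMonoid.IA (TraceMonoid.letter θ.Adj z₁ * w₁) = {z₁} →
          TraceMonoid.IA (TraceMonoid.letter θ.Adj z₁ * w₁') = {z₁} →
          TraceMonoid.IA (TraceMonoid.letter θ.Adj z₂ * w₂) = {z₂} →
          TraceMonoid.IA (TraceMonoid.letter θ.Adj z₂ * w₂') = {z₂} →
          TraceMonoid.letter θ.Adj z₁ * w₁ * (TraceMonoid.letter θ.Adj z₂ * w₂) =
            TraceMonoid.letter θ.Adj z₂ * w₂' * (TraceMonoid.letter θ.Adj z₁ * w₁') →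
          w₁ = w₁' ∧ w₂ = w₂',
      -- the dependence graph is the complement `θᶜ`
      ∀ z ∈ Bᶜ, ∀ z' ∈ Bᶜ, θ.Adj z z' →
        ¬ ∃ p : θᶜ.Walk z z', p.IsPath ∧ ∀ v ∈ p.support, v ≠ z → v ≠ z' → v ∈ B] := by
  tfae_have 1 → 2 := by
    intro hcode z₁ hz₁ z₂ hz₂ hne w₁ hw₁ w₂ hw₂ w₁' hw₁' w₂' hw₂' h1 h1' h2 h2' h
    let x₁ : beta θ.Adj B := ⟨_, z₁, hz₁, w₁, hw₁, h1, rfl⟩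
    let y₁ : beta θ.Adj B := ⟨_, z₁, hz₁, w₁', hw₁', h1', rfl⟩
    let x₂ : beta θ.Adj B := ⟨_, z₂, hz₂, w₂, hw₂, h2, rfl⟩
    let y₂ : beta θ.Adj B := ⟨_, z₂, hz₂, w₂', hw₂', h2', rfl⟩
    have key : letter (indep (beta θ.Adj B)) x₁ * letter _ x₂ = letter _ y₂ * letter _ y₁ :=
      hcode (by simpa [x₁, x₂, y₁, y₂] using h)
    have hx : ∀ x, x ∈ alph (letter (indep (beta θ.Adj B)) x₁ * letter _ x₂) ↔
        x ∈ alph (letter (indep (beta θ.Adj B)) y₂ * letter _ y₁) := fun x => by rw [key]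
    simp only [mem_alph_mul, mem_alph_letter] at hx
    have hIA : ∀ {x y : beta θ.Adj B} {z z' : A}, IA x.1 = {z} → IA y.1 = {z'} → x = y →
        z = z' := by
      rintro x _ z z' h h' rfl
      exact Set.singleton_injective (h.symm.trans h')
    constructor
    · rcases (hx x₁).1 (Or.inl rfl) with e | e
      · exact absurd (hIA h1 h2' e) hne
      · exact letter_mul_cancel hz₁ hw₁ hw₁' (congrArg Subtype.val e)
    · rcases (hx x₂).1 (Or.inr rfl) with e | e
      · exact letter_mul_cancel hz₂ hw₂ hw₂' (congrArg Subtype.val e)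
      · exact absurd (hIA h2 h1' e).symm hne
  tfae_have 2 → 3 := by
    rintro H z hz z' hz' hzz' ⟨p, -, hp⟩
    obtain ⟨u, hu, b, hb, hIA, hIA', hzu, hzb⟩ := exists_of_walk (B := B) hzz' p.reverse rfl
      (fun c hc => hp c (by simpa using hc)) hzz' 1 (one_mem _)
      (by rw [mul_one]; exact IA_letter _) (by simp) (by simp)
    have hbB : letter θ.Adj b ∈ sub θ.Adj B := Submonoid.subset_closure ⟨b, hb, rfl⟩
    have hcomm : u * letter θ.Adj z = letter θ.Adj z * u := mul_letter_comm_of_alph hzu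
    -- The equation is z · z'ub = z'u · zb; its conclusion would force 1 = b.
    have := H z hz z' hz' hzz'.ne 1 (one_mem _) (u * letter θ.Adj b) (mul_mem hu hbB)
      (letter θ.Adj b) hbB u hu (by rw [mul_one]; exact IA_letter _)
      (by rw [IA_mul_letter, IA_letter]; exact fun h => hzb (h z (by simp)).symm) hIA' hIA (by
        rw [mul_one, ← mul_assoc, letter_comm hzz', mul_assoc, mul_assoc, ← mul_assoc u, hcomm,
          mul_assoc])
    have hne := mul_letter_ne_one (r := θ.Adj) 1 b
    rw [one_mul] at hne
    exact hne this.1.symm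
  tfae_have 3 → 1 := fun H => NoPath.isTFSA H
  tfae_finish
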